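/- For an integer \(a\ge 1\), let \(g(a)\) be the smallest integer with the following property: for all pairwise disjoint convex sets \(D_1,\dots,D_a\subseteq\mathbb{R}^2\) there are convex polyhedra \(P_1,\dots,P_a\subseteq\mathbb{R}^2\) (intersections of finitely many closed half-planes, possibly unbounded) such that \(D_i\subseteq P_i\) for each \(i\), the interiors of \(P_i\) and \(P_j\) are disjoint for all \(i\ne j\), and the total number of facets of \(P_1,\dots,P_a\), i.e. \(\sum_{i=1}^a\#\{\text{facets of }P_i\}\), is at most \(g(a)\). (A facet of \(P\) is a nonempty face of dimension \(\dim P-1\).) Then, for every integer \(a\ge 3\), \(g(a)\) exists and \[ g(a)\le 6a-12 . \] Moreover, if \(D_1,\dots,D_a\) are in addition nonempty and compact, then \(P_1,\dots,P_a\) with these properties and with at most \(6a-12\) facets in total can be chosen so that every \(P_i\) has nonempty interior. -/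

import Mathlib

/-- The Euclidean plane. -/
abbrev Plane : Type := EuclideanSpace ℝ (Fin 2)

/-- A convex polyhedron in the plane: an intersection of finitely many closed halfspaces
`{x | c ≤ α · x}`. It may be unbounded. -/
def IsConvexPolyhedron (P : Set Plane) : Prop :=
  ∃ (k : ℕ) (α : Fin k → Plane) (c : Fin k → ℝ), P = {x | ∀ j, c j ≤ inner ℝ (α j) x}

/-- The facets of `P`: the nonempty (exposed) faces of dimension `dim P - 1`, where the
dimension of a nonempty set is that of its affine hull. -/
def facets (P : Set Plane) : Set (Set Plane) :=
  {F | F.Nonempty ∧ IsExposed ℝ P F ∧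
    Module.finrank ℝ (vectorSpan ℝ F) + 1 = Module.finrank ℝ (vectorSpan ℝ P)}

/-- `P` is a separating system for `D`: convex polyhedra with pairwise disjoint interiors, the
`i`-th of which contains the `i`-th set. -/
structure IsSeparatingSystem {a : ℕ} (D P : Fin a → Set Plane) : Prop where
  polyhedron : ∀ i, IsConvexPolyhedron (P i)
  subset : ∀ i, D i ⊆ P i
  interior_disjoint : Pairwise fun i j => Disjoint (interior (P i)) (interior (P j))

/-- The total number of facets of a family of sets (infinite sets would count as `⊤`). -/
noncomputable def totalFacets {a : ℕ} (P : Fin a → Set Plane) : ℕ∞ :=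
  ∑ i, (facets (P i)).encard

/-- The smallest `n` such that every family of `a` pairwise disjoint convex sets in the plane has
a separating system with at most `n` facets in total (`⊤` if no natural number does). -/
noncomputable def minFacetBound (a : ℕ) : ℕ∞ :=
  sInf {n : ℕ∞ | ∀ D : Fin a → Set Plane, (∀ i, Convex ℝ (D i)) →
    (Pairwise fun i j => Disjoint (D i) (D j)) →
    ∃ P : Fin a → Set Plane, IsSeparatingSystem D P ∧ totalFacets P ≤ n}

/-! Enlarge disjoint open convex sets to a family `C` in which no single member can be enlarged
further, and separate each pair by a line. Choose a direction `v` transversal to all these lines,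
and join two indices when their sets are consecutive on some line parallel to `v`. This visibility
graph has at most `3 * a - 6` edges, the Euler bound for planar graphs. Each nonempty `C i` is cut
out by the separating lines of its neighbours alone, so its closure has at most as many facets as
`i` has neighbours. Summing degrees gives `6 * a - 12`.

The edge bound (`card_consecutive_le`) comes from a sweep rather than from planarity: with `n ≥ 3`
sets met and `s ≥ 3` active, at most `3 * n - 3 - s` pairs have been consecutive so far.

The cutting lemma (`eq_setOf_lt_neighbours`) uses maximality twice. Let `Q` be the polygon of the
neighbours. Over the fibres meeting `C i`, `Q` avoids all other members, hence adds nothing to `C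
i`. Transversality of `v` then rules out a boundary point of `C i` inside `Q`, and connectedness of
`Q` gives `C i = Q`.

Arbitrary convex sets are treated through their interiors: a set without interior lies in a line,
which has neither facets nor interior. Compact sets are first thickened. -/

/-- The relation `R` restricts to a strict linear order on `S`. -/
structure IsStrictLinearOn {ι : Type*} (R : ι → ι → Prop) (S : Finset ι) : Prop where
  irrefl : ∀ i ∈ S, ¬ R i i
  total : ∀ i ∈ S, ∀ j ∈ S, i ≠ j → R i j ∨ R j i
  trans : ∀ i ∈ S, ∀ j ∈ S, ∀ k ∈ S, R i j → R j k → R i k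

namespace IsStrictLinearOn

variable {ι : Type*} {R : ι → ι → Prop} {S T : Finset ι}

theorem mono (h : IsStrictLinearOn R T) (hST : S ⊆ T) : IsStrictLinearOn R S where
  irrefl i hi := h.irrefl i (hST hi)
  total i hi j hj := h.total i (hST hi) j (hST hj)
  trans i hi j hj k hk := h.trans i (hST hi) j (hST hj) k (hST hk)

theorem asymm (h : IsStrictLinearOn R S) {i j : ι} (hi : i ∈ S) (hj : j ∈ S) (hij : R i j) :
    ¬ R j i :=
  fun hji => h.irrefl i hi (h.trans i hi j hj i hi hij hji)

theorem flip (h : IsStrictLinearOn R S) : IsStrictLinearOn (fun i j => R j i) S where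
  irrefl := h.irrefl
  total i hi j hj hij := (h.total i hi j hj hij).symm
  trans i hi j hj k hk hij hjk := h.trans k hk j hj i hi hjk hij

end IsStrictLinearOn

open Classical in
/-- The pairs of elements of `S` that are consecutive for `R`. -/
noncomputable def consecutivePairs {ι : Type*} (R : ι → ι → Prop) (S : Finset ι) :
    Finset (ι × ι) :=
  (S ×ˢ S).filter fun p => R p.1 p.2 ∧ ∀ k ∈ S, ¬ (R p.1 k ∧ R k p.2)

/-! ### Counting the pairs that become consecutive during a sweep. -/

section Sweep

variable {ι : Type*} {R : ι → ι → Prop}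

theorem mem_consecutivePairs {S : Finset ι} {i j : ι} :
    (i, j) ∈ consecutivePairs R S ↔
      i ∈ S ∧ j ∈ S ∧ R i j ∧ ∀ k ∈ S, ¬ (R i k ∧ R k j) := by
  simp [consecutivePairs, and_assoc]

/-- If `i` is below `j`, then some `k ≤ j` is directly above `i`. -/
theorem exists_consecutive_of_rel {S : Finset ι} (hR : IsStrictLinearOn R S) {i j : ι}
    (hi : i ∈ S) (hj : j ∈ S) (hij : R i j) :
    ∃ k, (i, k) ∈ consecutivePairs R S ∧ (k = j ∨ R k j) := by
  classical
  -- Among the candidates, take one with fewest elements below it; anything between `i` and it would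
  -- be a candidate with fewer.
  obtain ⟨k, hk, hmin⟩ := Finset.exists_min_image
    (S.filter fun k => R i k ∧ (k = j ∨ R k j)) (fun k => (S.filter fun m => R m k).card)
    ⟨j, Finset.mem_filter.2 ⟨hj, hij, Or.inl rfl⟩⟩
  rw [Finset.mem_filter] at hk
  refine ⟨k, mem_consecutivePairs.2 ⟨hi, hk.1, hk.2.1, ?_⟩, hk.2.2⟩
  rintro m hm ⟨him, hmk⟩
  have hmj : R m j := by
    rcases hk.2.2 with rfl | h
    · exact hmk
    · exact hR.trans _ hm _ hk.1 _ hj hmk h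
  refine absurd (hmin m (Finset.mem_filter.2 ⟨hm, him, Or.inr hmj⟩)) (not_le.2 ?_)
  refine Finset.card_lt_card (Finset.ssubset_iff.2 ⟨m, ?_, ?_⟩)
  · simp [hR.irrefl m hm]
  · intro l hl
    rcases Finset.mem_insert.1 hl with rfl | hl
    · exact Finset.mem_filter.2 ⟨hm, hmk⟩
    · rw [Finset.mem_filter] at hl ⊢
      exact ⟨hl.1, hR.trans _ hl.1 _ hm _ hk.1 hl.2 hmk⟩

/-- If `j` is below `i`, then some `k ≥ j` is directly below `i`. -/
theorem exists_consecutive_of_rel' {S : Finset ι} (hR : IsStrictLinearOn R S) {i j : ι}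
    (hi : i ∈ S) (hj : j ∈ S) (hji : R j i) :
    ∃ k, (k, i) ∈ consecutivePairs R S ∧ (k = j ∨ R j k) := by
  obtain ⟨k, hk, hkj⟩ := exists_consecutive_of_rel hR.flip hi hj hji
  rw [mem_consecutivePairs] at hk
  exact ⟨k, mem_consecutivePairs.2 ⟨hk.2.1, hk.1, hk.2.2.1,
    fun m hm h => hk.2.2.2 m hm h.symm⟩, hkj⟩

/-- `k` is the least or the greatest element of `S`. -/
def IsExtremalIn (R : ι → ι → Prop) (S : Finset ι) (k : ι) : Prop :=
  (∀ i ∈ S, ¬ R i k) ∨ (∀ i ∈ S, ¬ R k i)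

variable [DecidableEq ι]

/-- A new consecutive pair must involve `k`, so it joins `k` to its predecessor or to its successor;
an extremal `k` lacks one of the two. -/
theorem consecutivePairs_insert {S : Finset ι} {k : ι}
    (hR : IsStrictLinearOn R (insert k S)) (hk : k ∉ S) :
    ∃ A : Finset (ι × ι), consecutivePairs R (insert k S) ⊆ consecutivePairs R S ∪ A ∧
      A.card ≤ 2 ∧ (IsExtremalIn R S k → A.card ≤ 1) ∧ (S = ∅ → A.card = 0) := by
  classical
  set B := (consecutivePairs R (insert k S)).filter fun p => p.2 = k with hB
  set C := (consecutivePairs R (insert k S)).filter fun p => p.1 = k with hC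
  have hkk := hR.irrefl k (by simp)
  have memB : ∀ p ∈ B, p.2 = k ∧ p.1 ∈ S ∧ R p.1 k ∧ ∀ m ∈ S, ¬ (R p.1 m ∧ R m k) := by
    rintro ⟨i, j⟩ hp
    rw [hB, Finset.mem_filter, mem_consecutivePairs] at hp
    obtain ⟨⟨hi, hj, hij, hb⟩, rfl⟩ := hp
    refine ⟨rfl, ?_, hij, fun m hm => hb m (by simp [hm])⟩
    rcases Finset.mem_insert.1 hi with rfl | h
    · exact absurd hij hkk
    · exact h
  have memC : ∀ p ∈ C, p.1 = k ∧ p.2 ∈ S ∧ R k p.2 ∧ ∀ m ∈ S, ¬ (R k m ∧ R m p.2) := by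
    rintro ⟨i, j⟩ hp
    rw [hC, Finset.mem_filter, mem_consecutivePairs] at hp
    obtain ⟨⟨hi, hj, hij, hb⟩, rfl⟩ := hp
    refine ⟨rfl, ?_, hij, fun m hm => hb m (by simp [hm])⟩
    rcases Finset.mem_insert.1 hj with rfl | h
    · exact absurd hij hkk
    · exact h
  have hR' : IsStrictLinearOn R S := hR.mono (Finset.subset_insert _ _)
  have cardB : B.card ≤ 1 := by
    rw [Finset.card_le_one]
    rintro ⟨i, j⟩ hp ⟨i', j'⟩ hp'
    obtain ⟨h1, h2, h3, h4⟩ := memB _ hp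
    obtain ⟨h1', h2', h3', h4'⟩ := memB _ hp'
    simp only at *
    have : i = i' := by
      by_contra hne
      rcases hR'.total i h2 i' h2' hne with h | h
      · exact h4 _ h2' ⟨h, h3'⟩
      · exact h4' _ h2 ⟨h, h3⟩
    simp [this, h1, h1']
  have cardC : C.card ≤ 1 := by
    rw [Finset.card_le_one]
    rintro ⟨i, j⟩ hp ⟨i', j'⟩ hp'
    obtain ⟨h1, h2, h3, h4⟩ := memC _ hp
    obtain ⟨h1', h2', h3', h4'⟩ := memC _ hp'
    simp only at *
    have : j = j' := by
      by_contra hne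
      rcases hR'.total j h2 j' h2' hne with h | h
      · exact h4' _ h2 ⟨h3, h⟩
      · exact h4 _ h2' ⟨h3', h⟩
    simp [this, h1, h1']
  have hcard := Finset.card_union_le B C
  refine ⟨B ∪ C, ?_, by omega, ?_, ?_⟩
  · rintro ⟨i, j⟩ hp
    by_cases hj : j = k
    · exact Finset.mem_union_right _ (Finset.mem_union_left _ (Finset.mem_filter.2 ⟨hp, hj⟩))
    by_cases hi : i = k
    · exact Finset.mem_union_right _ (Finset.mem_union_right _ (Finset.mem_filter.2 ⟨hp, hi⟩))
    · refine Finset.mem_union_left _ ?_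
      rw [mem_consecutivePairs] at hp ⊢
      simp only [Finset.mem_insert, hi, hj, false_or] at hp
      exact ⟨hp.1, hp.2.1, hp.2.2.1, fun m hm => hp.2.2.2 m (Or.inr hm)⟩
  · rintro (h | h)
    · have : B = ∅ := Finset.eq_empty_of_forall_notMem fun p hp =>
        h _ (memB p hp).2.1 (memB p hp).2.2.1
      simp only [this, Finset.empty_union]; exact cardC
    · have : C = ∅ := Finset.eq_empty_of_forall_notMem fun p hp =>
        h _ (memC p hp).2.1 (memC p hp).2.2.1
      simp only [this, Finset.union_empty]; exact cardB
  · rintro rfl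
    have h1 : B = ∅ := Finset.eq_empty_of_forall_notMem fun p hp => by
      simpa using (memB p hp).2.1
    have h2 : C = ∅ := Finset.eq_empty_of_forall_notMem fun p hp => by
      simpa using (memC p hp).2.1
    simp [h1, h2]

/-- Only the predecessor and the successor of `k` can become consecutive, and an extremal `k` lacks
one of them. -/
theorem consecutivePairs_erase {S : Finset ι} {k : ι}
    (hR : IsStrictLinearOn R S) (hk : k ∈ S) :
    ∃ A : Finset (ι × ι), consecutivePairs R (S.erase k) ⊆ consecutivePairs R S ∪ A ∧
      A.card ≤ 1 ∧ (IsExtremalIn R S k → A.card = 0) ∧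
      ∀ p ∈ A, p.1 ∈ S.erase k ∧ p.2 ∈ S.erase k ∧ R p.1 k ∧ R k p.2 := by
  classical
  set A := (consecutivePairs R (S.erase k)).filter fun p => R p.1 k ∧ R k p.2 with hA
  have memA : ∀ p ∈ A, p.1 ∈ S.erase k ∧ p.2 ∈ S.erase k ∧ R p.1 k ∧ R k p.2 := by
    rintro ⟨i, j⟩ hp
    rw [hA, Finset.mem_filter, mem_consecutivePairs] at hp
    exact ⟨hp.1.1, hp.1.2.1, hp.2⟩
  refine ⟨A, ?_, ?_, ?_, memA⟩
  · rintro ⟨i, j⟩ hp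
    by_cases h : R i k ∧ R k j
    · exact Finset.mem_union_right _ (by simp [hA, hp, h])
    · refine Finset.mem_union_left _ ?_
      rw [mem_consecutivePairs] at hp ⊢
      refine ⟨Finset.mem_of_mem_erase hp.1, Finset.mem_of_mem_erase hp.2.1, hp.2.2.1,
        fun m hm => ?_⟩
      by_cases hmk : m = k
      · rw [hmk]; exact h
      · exact hp.2.2.2 m (Finset.mem_erase.2 ⟨hmk, hm⟩)
  · rw [Finset.card_le_one]
    rintro ⟨i, j⟩ hp ⟨i', j'⟩ hp'
    rw [hA, Finset.mem_filter, mem_consecutivePairs] at hp hp'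
    obtain ⟨⟨hi, hj, -, hb⟩, hik, hkj⟩ := hp
    obtain ⟨⟨hi', hj', -, hb'⟩, hik', hkj'⟩ := hp'
    simp only at hik hkj hik' hkj'
    have e := fun {x} (hx : x ∈ S.erase k) => Finset.mem_of_mem_erase hx
    have h1 : i = i' := by
      by_contra hne
      rcases hR.total i (e hi) i' (e hi') hne with h | h
      · exact hb _ hi' ⟨h, hR.trans _ (e hi') _ hk _ (e hj) hik' hkj⟩
      · exact hb' _ hi ⟨h, hR.trans _ (e hi) _ hk _ (e hj') hik hkj'⟩
    have h2 : j = j' := by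
      by_contra hne
      rcases hR.total j (e hj) j' (e hj') hne with h | h
      · exact hb' _ hj ⟨hR.trans _ (e hi') _ hk _ (e hj) hik' hkj, h⟩
      · exact hb _ hj' ⟨hR.trans _ (e hi) _ hk _ (e hj') hik hkj', h⟩
    rw [h1, h2]
  · intro h
    rw [Finset.card_eq_zero]
    refine Finset.eq_empty_of_forall_notMem fun p hp => ?_
    obtain ⟨h1, h2, h3, h4⟩ := memA p hp
    rcases h with h | h
    · exact h _ (Finset.mem_of_mem_erase h1) h3
    · exact h _ (Finset.mem_of_mem_erase h2) h4

/-- The invariant of a sweep through linearly ordered sets: `N` is the set of all elements met so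
far, `S` the current set, and `E` contains all pairs that were consecutive at some time. -/
structure SweepInvariant (R : ι → ι → Prop) (N S : Finset ι) (E : Finset (ι × ι)) : Prop where
  subset : S ⊆ N
  consecutive : consecutivePairs R S ⊆ E
  card_one : N.card ≤ 1 → E.card = 0
  card_two : N.card = 2 → E.card ≤ 1
  card_three : 3 ≤ N.card → E.card + 6 ≤ 3 * N.card
  card_current : 3 ≤ N.card → 3 ≤ S.card → E.card + S.card + 3 ≤ 3 * N.card
  extremes : 3 ≤ N.card → 3 ≤ S.card → E.card + S.card + 3 = 3 * N.card →
    ∃ b ∈ S, ∃ t ∈ S, (b, t) ∈ E ∧ (∀ i ∈ S, ¬ R i b) ∧ (∀ i ∈ S, ¬ R t i)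

theorem isExtremalIn_of_card_le_two {S : Finset ι} {k : ι} (hR : IsStrictLinearOn R S)
    (hk : k ∈ S) (h : S.card ≤ 2) : IsExtremalIn R S k := by
  by_contra hne
  simp only [IsExtremalIn, not_or, not_forall, not_not] at hne
  obtain ⟨⟨i, hi, hik⟩, j, hj, hkj⟩ := hne
  have h1 : i ≠ k := fun h => hR.irrefl k hk (h ▸ hik)
  have h2 : j ≠ k := fun h => hR.irrefl k hk (h ▸ hkj)
  have h3 : i ≠ j := fun h => hR.asymm hk hi (h ▸ hkj) hik
  have : ({i, j, k} : Finset ι) ⊆ S := by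
    intro x; simp only [Finset.mem_insert, Finset.mem_singleton]
    rintro (rfl | rfl | rfl) <;> assumption
  have := Finset.card_le_card this
  rw [Finset.card_eq_three.2 ⟨i, j, k, h3, h1, h2, rfl⟩] at this
  omega

theorem exists_consecutive_of_card_eq_two {S : Finset ι} (hR : IsStrictLinearOn R S)
    (h : S.card = 2) : ∃ b ∈ S, ∃ t ∈ S, (b, t) ∈ consecutivePairs R S ∧
      (∀ i ∈ S, ¬ R i b) ∧ (∀ i ∈ S, ¬ R t i) := by
  obtain ⟨x, y, hxy, rfl⟩ := Finset.card_eq_two.1 h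
  have key : ∀ b t, b ∈ ({x, y} : Finset ι) → t ∈ ({x, y} : Finset ι) →
      (∀ i ∈ ({x, y} : Finset ι), i = b ∨ i = t) → R b t →
      ∃ b ∈ ({x, y} : Finset ι), ∃ t ∈ ({x, y} : Finset ι),
        (b, t) ∈ consecutivePairs R {x, y} ∧ (∀ i ∈ ({x, y} : Finset ι), ¬ R i b) ∧
          (∀ i ∈ ({x, y} : Finset ι), ¬ R t i) := by
    intro b t hb ht hall hbt
    have h1 : ∀ i ∈ ({x, y} : Finset ι), ¬ R i b := by
      intro i hi
      rcases hall i hi with rfl | rfl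
      · exact hR.irrefl _ hb
      · exact hR.asymm hb ht hbt
    have h2 : ∀ i ∈ ({x, y} : Finset ι), ¬ R t i := by
      intro i hi
      rcases hall i hi with rfl | rfl
      · exact hR.asymm hb ht hbt
      · exact hR.irrefl _ ht
    refine ⟨b, hb, t, ht, mem_consecutivePairs.2 ⟨hb, ht, hbt, ?_⟩, h1, h2⟩
    rintro k hk ⟨h3, h4⟩
    rcases hall k hk with rfl | rfl
    · exact h1 _ hb h3
    · exact h2 _ ht h4
  rcases hR.total x (by simp) y (by simp) hxy with h | h
  · exact key x y (by simp) (by simp) (by simp) h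
  · exact key y x (by simp) (by simp) (by simp [or_comm]) h

/-- Both cardinalities grow by one, so `3 * n - 3 - s` grows by 2, which pays for the at most two
new pairs. Equality forces exactly two, so `k` is not extremal and the old extreme pair persists. -/
theorem SweepInvariant.insert {N S : Finset ι} {E : Finset (ι × ι)} (h : SweepInvariant R N S E)
    {k : ι} (hk : k ∉ N) (hR : IsStrictLinearOn R (insert k S)) :
    SweepInvariant R (insert k N) (insert k S) (E ∪ consecutivePairs R (insert k S)) := by
  have hkS : k ∉ S := fun hS => hk (h.subset hS)
  have hR' : IsStrictLinearOn R S := hR.mono (Finset.subset_insert _ _)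
  obtain ⟨A, hA, hA2, hA1, hA0⟩ := consecutivePairs_insert hR hkS
  have hE : (E ∪ consecutivePairs R (Insert.insert k S)).card ≤ E.card + A.card := by
    refine (Finset.card_le_card ?_).trans (Finset.card_union_le _ _)
    exact Finset.union_subset Finset.subset_union_left
      (hA.trans (Finset.union_subset_union_left h.consecutive))
  have hN : (Insert.insert k N).card = N.card + 1 := Finset.card_insert_of_notMem hk
  have hS : (Insert.insert k S).card = S.card + 1 := Finset.card_insert_of_notMem hkS
  have hSN := Finset.card_le_card h.subset
  have hext : S.card = 1 → A.card ≤ 1 := by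
    intro h1
    refine hA1 ?_
    rcases isExtremalIn_of_card_le_two hR (Finset.mem_insert_self k S) (by omega) with h | h
    · exact Or.inl fun i hi => h i (Finset.mem_insert_of_mem hi)
    · exact Or.inr fun i hi => h i (Finset.mem_insert_of_mem hi)
  have hzero : S.card = 0 → A.card = 0 := fun h0 => hA0 (Finset.card_eq_zero.1 h0)
  have h1 := h.card_one
  have h2 := h.card_two
  have h3 := h.card_three
  have h4 := h.card_current
  refine ⟨Finset.insert_subset_insert _ h.subset, Finset.subset_union_right, ?_, ?_, ?_, ?_, ?_⟩
  · intro hc; have := h1 (by omega); have := hzero (by omega); omega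
  · intro hc; have := h1 (by omega)
    rcases Nat.lt_or_ge S.card 1 with hs | hs
    · have := hzero (by omega); omega
    · have := hext (by omega); omega
  · intro hc
    rcases Nat.lt_or_ge N.card 3 with hs | hs
    · have := h2 (by omega); omega
    · have := h3 hs; omega
  · intro hc hc'
    rcases Nat.lt_or_ge N.card 3 with hs | hs
    · have := h2 (by omega); omega
    · have := h3 hs
      rcases Nat.lt_or_ge S.card 3 with hs' | hs'
      · omega
      · have := h4 hs hs'; omega
  · intro hc hc' heq
    have hcard : A.card = 2 := by
      rcases Nat.lt_or_ge N.card 3 with hs | hs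
      · have := h2 (by omega); omega
      · have := h3 hs
        rcases Nat.lt_or_ge S.card 3 with hs' | hs'
        · omega
        · have := h4 hs hs'; omega
    have hnext : ¬ IsExtremalIn R S k := fun hx => by have := hA1 hx; omega
    obtain ⟨b, hb, t, ht, hbt, hb', ht'⟩ : ∃ b ∈ S, ∃ t ∈ S, (b, t) ∈ E ∧
        (∀ i ∈ S, ¬ R i b) ∧ (∀ i ∈ S, ¬ R t i) := by
      rcases Nat.lt_or_ge N.card 3 with hs | hs
      · obtain ⟨b, hb, t, ht, hbt, hr⟩ := exists_consecutive_of_card_eq_two hR' (by omega)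
        exact ⟨b, hb, t, ht, h.consecutive hbt, hr⟩
      · have := h3 hs
        rcases Nat.lt_or_ge S.card 3 with hs' | hs'
        · omega
        · have := h4 hs hs'
          exact h.extremes hs hs' (by omega)
    simp only [IsExtremalIn, not_or, not_forall, not_not] at hnext
    obtain ⟨⟨i, hi, hik⟩, j, hj, hkj⟩ := hnext
    have m := fun {x} (hx : x ∈ S) => Finset.mem_insert_of_mem (b := k) hx
    have hkm := Finset.mem_insert_self k S
    refine ⟨b, m hb, t, m ht, Finset.mem_union_left _ hbt, ?_, ?_⟩
    · intro x hx
      rcases Finset.mem_insert.1 hx with rfl | hx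
      · exact fun hxb => hb' i hi (hR.trans _ (m hi) _ hkm _ (m hb) hik hxb)
      · exact hb' x hx
    · intro x hx
      rcases Finset.mem_insert.1 hx with rfl | hx
      · exact fun hxb => ht' j hj (hR.trans _ (m ht) _ hkm _ (m hj) hxb hkj)
      · exact ht' x hx

/-- Lowering `s` by one pays for the at most one new pair. The critical case is the passage from
three active elements to two, where the bound stays at `3 * n - 6`; the field `extremes` exists for
this case. -/
theorem SweepInvariant.erase {N S : Finset ι} {E : Finset (ι × ι)} (h : SweepInvariant R N S E)
    {k : ι} (hk : k ∈ S) (hR : IsStrictLinearOn R S) :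
    SweepInvariant R N (S.erase k) (E ∪ consecutivePairs R (S.erase k)) := by
  obtain ⟨A, hA, hA1, hA0, hAmem⟩ := consecutivePairs_erase hR hk
  have hsub : E ∪ consecutivePairs R (S.erase k) ⊆ E ∪ A :=
    Finset.union_subset Finset.subset_union_left
      (hA.trans (Finset.union_subset_union_left h.consecutive))
  have hE : (E ∪ consecutivePairs R (S.erase k)).card ≤ E.card + A.card :=
    (Finset.card_le_card hsub).trans (Finset.card_union_le _ _)
  have hS : (S.erase k).card = S.card - 1 := Finset.card_erase_of_mem hk
  have hpos : 0 < S.card := Finset.card_pos.2 ⟨k, hk⟩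
  have hSN := Finset.card_le_card h.subset
  have hsmall : S.card ≤ 2 → A.card = 0 := fun hc => hA0 (isExtremalIn_of_card_le_two hR hk hc)
  have h1 := h.card_one
  have h2 := h.card_two
  have h3 := h.card_three
  have h4 := h.card_current
  refine ⟨(Finset.erase_subset _ _).trans h.subset, Finset.subset_union_right, ?_, ?_, ?_, ?_, ?_⟩
  · intro hc; have := h1 hc; have := hsmall (by omega); omega
  · intro hc; have := h2 hc; have := hsmall (by omega); omega
  · intro hc
    have := h3 hc
    rcases Nat.lt_or_ge S.card 3 with hs | hs
    · have := hsmall (by omega); omega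
    have := h4 hc hs
    by_contra hcon
    have hs3 : S.card = 3 := by omega
    obtain ⟨b, hb, t, ht, hbt, hb', ht'⟩ := h.extremes hc hs (by omega)
    -- When `S` is `b`, `k`, `t` in order, the only possible new pair is `(b, t)`, which is already
    -- in `E`.
    have hAE : A ⊆ E := by
      rintro ⟨i, j⟩ hp
      obtain ⟨hi, hj, hik, hkj⟩ := hAmem _ hp
      simp only at hi hj hik hkj
      have hi' := Finset.mem_of_mem_erase hi
      have hj' := Finset.mem_of_mem_erase hj
      have hij : i ≠ j := fun h => hR.asymm hk hi' (h ▸ hkj) hik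
      have hall : S = {i, j, k} := by
        refine (Finset.eq_of_subset_of_card_le ?_ ?_).symm
        · intro x; simp only [Finset.mem_insert, Finset.mem_singleton]
          rintro (rfl | rfl | rfl) <;> assumption
        · rw [Finset.card_eq_three.2 ⟨i, j, k, hij, (Finset.mem_erase.1 hi).1,
            (Finset.mem_erase.1 hj).1, rfl⟩]; omega
      have hijR := hR.trans _ hi' _ hk _ hj' hik hkj
      have hbi : b = i := by
        rw [hall] at hb
        simp only [Finset.mem_insert, Finset.mem_singleton] at hb
        rcases hb with h | rfl | rfl
        · exact h
        · exact absurd hkj (hb' _ hk)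
        · exact absurd hik (hb' _ hi')
      have htj : t = j := by
        rw [hall] at ht
        simp only [Finset.mem_insert, Finset.mem_singleton] at ht
        rcases ht with rfl | h | rfl
        · exact absurd hik (ht' _ hk)
        · exact h
        · exact absurd hkj (ht' _ hj')
      rw [← hbi, ← htj]; exact hbt
    have := Finset.card_le_card hsub
    rw [Finset.union_eq_left.2 hAE] at this
    omega
  · intro hc hc'
    have := h4 hc (by omega)
    omega
  · intro hc hc' heq
    have := h4 hc (by omega)
    obtain ⟨b, hb, t, ht, hbt, hb', ht'⟩ := h.extremes hc (by omega) (by omega)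
    have hnext : ¬ IsExtremalIn R S k := fun hx => by have := hA0 hx; omega
    have hbk : b ≠ k := by rintro rfl; exact hnext (Or.inl hb')
    have htk : t ≠ k := by rintro rfl; exact hnext (Or.inr ht')
    exact ⟨b, Finset.mem_erase.2 ⟨hbk, hb⟩, t, Finset.mem_erase.2 ⟨htk, ht⟩,
      Finset.mem_union_left _ hbt, fun i hi => hb' i (Finset.mem_of_mem_erase hi),
      fun i hi => ht' i (Finset.mem_of_mem_erase hi)⟩

theorem SweepInvariant.sdiff {N S : Finset ι} {E : Finset (ι × ι)} (h : SweepInvariant R N S E)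
    (hR : IsStrictLinearOn R S) (T : Finset ι) (hT : T ⊆ S) :
    ∃ E', E ⊆ E' ∧ SweepInvariant R N (S \ T) E' := by
  induction T using Finset.induction_on with
  | empty => exact ⟨E, subset_rfl, by simpa using h⟩
  | insert k T hk ih =>
    obtain ⟨E', hE', h'⟩ := ih ((Finset.subset_insert _ _).trans hT)
    have hkS : k ∈ S \ T := Finset.mem_sdiff.2 ⟨hT (Finset.mem_insert_self _ _), hk⟩
    have := h'.erase hkS (hR.mono Finset.sdiff_subset)
    rw [← Finset.sdiff_insert] at this
    exact ⟨_, hE'.trans Finset.subset_union_left, this⟩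

theorem SweepInvariant.union {N S : Finset ι} {E : Finset (ι × ι)} (h : SweepInvariant R N S E)
    (T : Finset ι) (hR : IsStrictLinearOn R (S ∪ T)) (hT : Disjoint T N) :
    ∃ E', E ⊆ E' ∧ SweepInvariant R (N ∪ T) (S ∪ T) E' := by
  induction T using Finset.induction_on with
  | empty => exact ⟨E, subset_rfl, by simpa using h⟩
  | insert k T hk ih =>
    rw [Finset.disjoint_insert_left] at hT
    rw [Finset.union_insert] at hR
    obtain ⟨E', hE', h'⟩ := ih (hR.mono (Finset.subset_insert _ _)) hT.2
    rw [Finset.union_insert, Finset.union_insert]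
    exact ⟨_, hE'.trans Finset.subset_union_left, h'.insert (by simp [hT.1, hk]) hR⟩

/-- Sweeping over a family of intervals with a consistent linear order of the active ones: at most
`3 * n - 6` pairs are consecutive at some time. -/
theorem card_consecutive_le [Fintype ι] (hι : 3 ≤ Fintype.card ι) (S : ℝ → Finset ι)
    (hS : ∀ x y z, x ≤ y → y ≤ z → ∀ i ∈ S x, i ∈ S z → i ∈ S y)
    (hR : ∀ x, IsStrictLinearOn R (S x)) (E : Finset (ι × ι))
    (hE : ∀ p ∈ E, ∃ x, p ∈ consecutivePairs R (S x)) :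
    E.card + 6 ≤ 3 * Fintype.card ι := by
  classical
  have main : ∀ T : Finset ℝ, ∃ N C E', SweepInvariant R N C E' ∧
      (∀ x ∈ T, S x ⊆ N) ∧ (∀ x ∈ T, consecutivePairs R (S x) ⊆ E') ∧
      (∀ i ∈ N, ∃ x ∈ T, i ∈ S x) ∧ (∀ x ∈ T, (∀ y ∈ T, y ≤ x) → C = S x) ∧
      (T = ∅ → C = ∅) := by
    intro T
    induction T using Finset.induction_on_max with
    | empty =>
      refine ⟨∅, ∅, ∅, ⟨by simp, ?_, by simp, by simp, by simp, by simp, by simp⟩, by simp,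
        by simp, by simp, by simp, by simp⟩
      simp [consecutivePairs]
    | insert x T hx ih =>
      obtain ⟨N, C, E', hinv, hN, hcon, hseen, hcur, hemp⟩ := ih
      -- Activity times form intervals: an element met earlier and active at `x` was active at the
      -- latest earlier time. So no element is ever reinserted.
      have hlast : N ∩ S x ⊆ C ∧ IsStrictLinearOn R C := by
        rcases T.eq_empty_or_nonempty with rfl | hT
        · rw [hemp rfl]
          refine ⟨fun i hi => ?_, ⟨by simp, by simp, by simp⟩⟩
          obtain ⟨y, hy, -⟩ := hseen i (Finset.mem_inter.1 hi).1
          simp at hy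
        · have hmax := hcur _ (T.max'_mem hT) fun y hy => T.le_max' y hy
          refine ⟨fun i hi => ?_, hmax ▸ hR _⟩
          obtain ⟨y, hy, hiy⟩ := hseen i (Finset.mem_inter.1 hi).1
          rw [hmax]
          exact hS y _ x (T.le_max' y hy) (hx _ (T.max'_mem hT)).le i hiy
            (Finset.mem_inter.1 hi).2
      obtain ⟨E₁, hE₁, h₁⟩ := hinv.sdiff hlast.2 (C \ S x) Finset.sdiff_subset
      have hCS : C \ (C \ S x) = C ∩ S x := by ext; simp
      rw [hCS] at h₁
      have hunion : C ∩ S x ∪ (S x \ N) = S x := by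
        ext i
        have := @hlast.1 i
        simp only [Finset.mem_inter, Finset.mem_union, Finset.mem_sdiff] at this ⊢
        tauto
      obtain ⟨E₂, hE₂, h₂⟩ := h₁.union (S x \ N) (by rw [hunion]; exact hR x)
        Finset.sdiff_disjoint
      rw [hunion] at h₂
      refine ⟨_, _, _, h₂, ?_, ?_, ?_, ?_, by simp⟩
      · intro y hy
        rcases Finset.mem_insert.1 hy with rfl | hy
        · intro i hi; simp [hi]
        · exact (hN y hy).trans Finset.subset_union_left
      · intro y hy
        rcases Finset.mem_insert.1 hy with rfl | hy
        · exact h₂.consecutive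
        · exact (hcon y hy).trans (hE₁.trans hE₂)
      · intro i hi
        rcases Finset.mem_union.1 hi with hi | hi
        · obtain ⟨y, hy, h⟩ := hseen i hi
          exact ⟨y, Finset.mem_insert_of_mem hy, h⟩
        · exact ⟨x, Finset.mem_insert_self _ _, (Finset.mem_sdiff.1 hi).1⟩
      · intro y hy hmax
        rcases Finset.mem_insert.1 hy with rfl | hy
        · rfl
        · exact absurd (hx y hy) (not_lt.2 (hmax x (Finset.mem_insert_self _ _)))
  choose! time htime using hE
  obtain ⟨N, C, E', hinv, -, hcon, -⟩ := main (E.image time)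
  have hsub : E ⊆ E' := fun p hp => hcon _ (Finset.mem_image_of_mem _ hp) (htime p hp)
  have h1 := Finset.card_le_card hsub
  have h2 := Finset.card_le_univ N
  have h3 := hinv.card_one
  have h4 := hinv.card_two
  have h5 := hinv.card_three
  rcases Nat.lt_or_ge N.card 3 with h | h
  · rcases Nat.lt_or_ge N.card 2 with h' | h'
    · have := h3 (by omega); omega
    · have := h4 (by omega); omega
  · have := h5 h; omega

end Sweep

open Set Topology

/-! ### Maximal families and transversal directions. -/

/-- Every family of pairwise disjoint open convex sets can be enlarged to a family in which no
single member can be enlarged further. -/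
theorem exists_maximal_disjoint_open_convex {ι E : Type*} [TopologicalSpace E] [AddCommGroup E]
    [Module ℝ E] [DecidableEq ι] (O : ι → Set E)
    (hO : ∀ i, IsOpen (O i)) (hc : ∀ i, Convex ℝ (O i))
    (hd : Pairwise fun i j => Disjoint (O i) (O j)) :
    ∃ C : ι → Set E, (∀ i, O i ⊆ C i) ∧ (∀ i, IsOpen (C i)) ∧ (∀ i, Convex ℝ (C i)) ∧
      (Pairwise fun i j => Disjoint (C i) (C j)) ∧
      ∀ i T, IsOpen T → Convex ℝ T → C i ⊆ T → (∀ j, j ≠ i → Disjoint T (C j)) → T ⊆ C i := by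
  obtain ⟨C, hOC, hC⟩ := zorn_le_nonempty₀
    {C : ι → Set E | (∀ i, IsOpen (C i)) ∧ (∀ i, Convex ℝ (C i)) ∧
      Pairwise fun i j => Disjoint (C i) (C j)} (by
    intro c hcs hchain y hy
    refine ⟨fun i => ⋃ D ∈ c, D i, ⟨?_, ?_, ?_⟩, ?_⟩
    · exact fun i => isOpen_biUnion fun D hD => (hcs hD).1 i
    · intro i
      simp only [biUnion_eq_iUnion]
      refine Directed.convex_iUnion ?_ fun D => (hcs D.2).2.1 i
      rintro ⟨D, hD⟩ ⟨D', hD'⟩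
      rcases hchain.total hD hD' with h | h
      · exact ⟨⟨D', hD'⟩, h i, subset_rfl⟩
      · exact ⟨⟨D, hD⟩, subset_rfl, h i⟩
    · intro i j hij
      simp only [disjoint_iUnion_left, disjoint_iUnion_right]
      intro D' hD' D hD
      rcases hchain.total hD hD' with h | h
      · exact ((hcs hD').2.2 hij).mono_left (h i)
      · exact ((hcs hD).2.2 hij).mono_right (h j)
    · exact fun D hD i => subset_biUnion_of_mem (u := fun D : ι → Set E => D i) hD) O ⟨hO, hc, hd⟩
  refine ⟨C, hOC, hC.prop.1, hC.prop.2.1, hC.prop.2.2, ?_⟩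
  intro i T hT hTc hCT hTd
  have hle : C ≤ Function.update C i T := by
    intro j
    by_cases h : j = i
    · subst h; simpa using hCT
    · simp [h]
  have := hC.le_of_ge (y := Function.update C i T) ⟨?_, ?_, ?_⟩ hle i
  · simpa using this
  · intro j
    by_cases h : j = i
    · subst h; simpa using hT
    · simpa [h] using hC.prop.1 j
  · intro j
    by_cases h : j = i
    · subst h; simpa using hTc
    · simpa [h] using hC.prop.2.1 j
  · intro j k hjk
    by_cases h : j = i
    · subst h; simpa [hjk.symm] using hTd k hjk.symm
    · by_cases h' : k = i
      · subst h'; simpa [h] using (hTd j h).symm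
      · simpa [h, h'] using hC.prop.2.2 hjk

/-- A direction `v` transversal to finitely many lines, together with linear coordinates for which
the fibres of the first one are parallel to `v`. -/
theorem exists_transversal_direction {κ : Type*} [Finite κ] (f : κ → StrongDual ℝ Plane) :
    ∃ (φ h : Plane →ₗ[ℝ] ℝ) (v : Plane), φ v = 0 ∧
      (∀ p, φ p = 0 → h p = 0 → p = 0) ∧ ∀ k, f k ≠ 0 → f k v ≠ 0 := by
  -- A nonzero functional vanishes on at most one direction `(1, t)`, since two such directions span
  -- the plane.
  have hfin : (⋃ k, {t : ℝ | f k ≠ 0 ∧ f k !₂[1, t] = 0}).Finite := by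
    refine Set.finite_iUnion fun k => Set.Subsingleton.finite ?_
    rintro t ⟨hk, ht⟩ s ⟨-, hs⟩
    by_contra hne
    apply hk
    have h0 : f k !₂[0, 1] = 0 := by
      have : (t - s) • (!₂[0, 1] : Plane) = !₂[1, t] - !₂[1, s] := by
        ext i; fin_cases i <;> simp
      have h := congrArg (f k) this
      rw [map_smul, map_sub, ht, hs, smul_eq_mul, sub_zero] at h
      exact (mul_eq_zero.1 h).resolve_left (sub_ne_zero.2 hne)
    ext p
    have : p = p 0 • (!₂[1, t] : Plane) + (p 1 - t * p 0) • !₂[0, 1] := by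
      ext i; fin_cases i <;> simp; ring
    rw [this, map_add, map_smul, map_smul, ht, h0]
    simp
  obtain ⟨t, ht⟩ := hfin.exists_notMem
  refine ⟨↑(EuclideanSpace.proj 1 - t • EuclideanSpace.proj 0 : StrongDual ℝ Plane),
    ↑(EuclideanSpace.proj 0 : StrongDual ℝ Plane), !₂[1, t],
    by simp, ?_, ?_⟩
  · intro p h1 h2
    simp at h1 h2
    ext i; fin_cases i
    · simpa using h2
    · simpa [h2] using h1
  · intro k hk h0
    exact ht (mem_iUnion.2 ⟨k, hk, h0⟩)

/-! ### The vertical order of disjoint convex sets. -/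

section Fibres

variable {E ι : Type*} [AddCommGroup E] [Module ℝ E] {φ h : E →ₗ[ℝ] ℝ} {C : ι → Set E}

/-- `i` is below `j`: on some common fibre of `φ` a point of `C i` is below one of `C j`. -/
def IsBelow (φ h : E →ₗ[ℝ] ℝ) (C : ι → Set E) (i j : ι) : Prop :=
  i ≠ j ∧ ∃ p ∈ C i, ∃ q ∈ C j, φ p = φ q ∧ h p < h q

theorem eq_of_coord_eq (hφ : ∀ p, φ p = 0 → h p = 0 → p = 0) {p q : E} (h1 : φ p = φ q)
    (h2 : h p = h q) : p = q :=
  sub_eq_zero.1 (hφ _ (by simp [h1]) (by simp [h2]))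

/-- In a family of disjoint convex sets, being below is independent of the fibre and the points. -/
theorem IsBelow.lt (hφ : ∀ p, φ p = 0 → h p = 0 → p = 0) (hc : ∀ i, Convex ℝ (C i))
    (hd : Pairwise fun i j => Disjoint (C i) (C j)) {i j : ι} (hij : IsBelow φ h C i j)
    {p q : E} (hp : p ∈ C i) (hq : q ∈ C j) (hpq : φ p = φ q) : h p < h q := by
  obtain ⟨hne, p', hp', q', hq', hpq', hlt⟩ := hij
  by_contra! hle
  -- The parameter at which the interpolated height difference vanishes: there the two segments
  -- meet, against disjointness.
  set s := (h p - h q) / ((h p - h q) + (h q' - h p')) with hs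
  have hpos : 0 < (h p - h q) + (h q' - h p') := by linarith
  have hs0 : 0 ≤ s := div_nonneg (by linarith) hpos.le
  have hs1 : 0 ≤ 1 - s := by
    rw [hs, sub_nonneg, div_le_one hpos]; linarith
  have hsm : s * ((h p - h q) + (h q' - h p')) = h p - h q := div_mul_cancel₀ _ hpos.ne'
  have hx := hc i hp hp' hs1 hs0 (by ring)
  have hy := hc j hq hq' hs1 hs0 (by ring)
  have : (1 - s) • p + s • p' = (1 - s) • q + s • q' := by
    apply eq_of_coord_eq hφ
    · simp [hpq, hpq']
    · simp only [map_add, map_smul, smul_eq_mul]; linarith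
  exact Set.disjoint_left.1 (hd hne) hx (this ▸ hy)

/-- On each fibre of `φ`, a family of disjoint convex sets is linearly ordered by height. -/
theorem isStrictLinearOn_isBelow [Fintype ι] (hφ : ∀ p, φ p = 0 → h p = 0 → p = 0)
    (hc : ∀ i, Convex ℝ (C i)) (hd : Pairwise fun i j => Disjoint (C i) (C j))
    (S : Finset ι) (x : ℝ) (hS : ∀ i ∈ S, x ∈ φ '' C i) :
    IsStrictLinearOn (IsBelow φ h C) S where
  irrefl i _ hi := hi.1 rfl
  total i hi j hj hij := by
    obtain ⟨p, hp, hpx⟩ := hS i hi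
    obtain ⟨q, hq, hqx⟩ := hS j hj
    rcases lt_trichotomy (h p) (h q) with hlt | heq | hlt
    · exact Or.inl ⟨hij, p, hp, q, hq, hpx.trans hqx.symm, hlt⟩
    · have := eq_of_coord_eq hφ (hpx.trans hqx.symm) heq
      exact absurd (this ▸ hq) (Set.disjoint_left.1 (hd hij) hp)
    · exact Or.inr ⟨hij.symm, q, hq, p, hp, hqx.trans hpx.symm, hlt⟩
  trans i hi j hj k hk hij hjk := by
    obtain ⟨p, hp, hpx⟩ := hS i hi
    obtain ⟨q, hq, hqx⟩ := hS j hj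
    obtain ⟨r, hr, hrx⟩ := hS k hk
    have h1 := hij.lt hφ hc hd hp hq (hpx.trans hqx.symm)
    have h2 := hjk.lt hφ hc hd hq hr (hqx.trans hrx.symm)
    refine ⟨?_, p, hp, r, hr, hpx.trans hrx.symm, h1.trans h2⟩
    rintro rfl
    exact lt_asymm h1 (hjk.lt hφ hc hd hq hp (hqx.trans hpx.symm))

open Classical in
/-- The members of the family that meet the fibre of `φ` over `x`. -/
noncomputable def activeOn [Fintype ι] (φ : E →ₗ[ℝ] ℝ) (C : ι → Set E) (x : ℝ) : Finset ι :=
  Finset.univ.filter fun i => x ∈ φ '' C i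

open Classical in
/-- The pairs that are consecutive on some fibre of `φ`. -/
noncomputable def visiblePairs [Fintype ι] (φ h : E →ₗ[ℝ] ℝ) (C : ι → Set E) : Finset (ι × ι) :=
  Finset.univ.filter fun p => ∃ x, p ∈ consecutivePairs (IsBelow φ h C) (activeOn φ C x)

theorem card_visiblePairs_le [Fintype ι] (hι : 3 ≤ Fintype.card ι)
    (hφ : ∀ p, φ p = 0 → h p = 0 → p = 0)
    (hc : ∀ i, Convex ℝ (C i)) (hd : Pairwise fun i j => Disjoint (C i) (C j)) :
    (visiblePairs φ h C).card + 6 ≤ 3 * Fintype.card ι := by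
  classical
  refine card_consecutive_le (R := IsBelow φ h C) hι (activeOn φ C) ?_ ?_ _ ?_
  · intro x y z hxy hyz i hx hz
    simp only [activeOn, Finset.mem_filter, Finset.mem_univ, true_and] at hx hz ⊢
    exact ((hc i).linear_image φ).ordConnected.out hx hz ⟨hxy, hyz⟩
  · intro x
    exact isStrictLinearOn_isBelow hφ hc hd _ x fun i hi => by simpa [activeOn] using hi
  · intro p hp
    simpa [visiblePairs] using hp

end Fibres


/-! ### Neighbours in the visibility graph. -/

section Neighbours

variable {E ι : Type*} [AddCommGroup E] [Module ℝ E] {φ h : E →ₗ[ℝ] ℝ} {C : ι → Set E}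

theorem Convex.mem_of_coord_between {S : Set E} (hS : Convex ℝ S)
    (hφ : ∀ p, φ p = 0 → h p = 0 → p = 0) {y w z : E} (hy : y ∈ S) (hz : z ∈ S)
    (h1 : φ y = φ z) (h2 : φ w = φ z) (h3 : h y < h w) (h4 : h w < h z) : w ∈ S := by
  have hpos : 0 < h z - h y := by linarith
  set s := (h w - h y) / (h z - h y) with hs
  have hs0 : 0 ≤ s := div_nonneg (by linarith) hpos.le
  have hs1 : 0 ≤ 1 - s := by rw [hs, sub_nonneg, div_le_one hpos]; linarith
  have hsm : s * (h z - h y) = h w - h y := div_mul_cancel₀ _ hpos.ne'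
  have : w = (1 - s) • y + s • z := by
    apply eq_of_coord_eq hφ
    · simp only [map_add, map_smul, smul_eq_mul, h1, h2]; ring
    · simp only [map_add, map_smul, smul_eq_mul]; linarith
  rw [this]
  exact hS hy hz hs1 hs0 (by ring)

open Classical in
/-- The members that are directly above or below `C i` on some fibre of `φ`. -/
noncomputable def neighbours [Fintype ι] (φ h : E →ₗ[ℝ] ℝ) (C : ι → Set E) (i : ι) : Finset ι :=
  Finset.univ.filter fun k => (i, k) ∈ visiblePairs φ h C ∨ (k, i) ∈ visiblePairs φ h C

theorem ne_of_mem_visiblePairs [Fintype ι] {i k : ι} (hik : (i, k) ∈ visiblePairs φ h C) :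
    i ≠ k := by
  simp only [visiblePairs, Finset.mem_filter, mem_consecutivePairs] at hik
  obtain ⟨-, x, hx⟩ := hik
  exact hx.2.2.1.1

theorem ne_of_mem_neighbours [Fintype ι] {i k : ι} (hik : k ∈ neighbours φ h C i) : i ≠ k := by
  simp only [neighbours, Finset.mem_filter] at hik
  rcases hik.2 with h | h
  · exact ne_of_mem_visiblePairs h
  · exact (ne_of_mem_visiblePairs h).symm

theorem sum_card_neighbours_le [Fintype ι] :
    ∑ i, (neighbours φ h C i).card ≤ 2 * (visiblePairs φ h C).card := by
  classical
  have h1 : ∀ i, (neighbours φ h C i).card ≤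
      ((visiblePairs φ h C).filter fun p => p.1 = i).card +
        ((visiblePairs φ h C).filter fun p => p.2 = i).card := by
    intro i
    have : neighbours φ h C i ⊆
        (((visiblePairs φ h C).filter fun p => p.1 = i).image Prod.snd) ∪
          (((visiblePairs φ h C).filter fun p => p.2 = i).image Prod.fst) := by
      intro k hk
      simp only [neighbours, Finset.mem_filter] at hk
      rcases hk.2 with h | h
      · exact Finset.mem_union_left _ (Finset.mem_image.2 ⟨_, Finset.mem_filter.2 ⟨h, rfl⟩, rfl⟩)
      · exact Finset.mem_union_right _ (Finset.mem_image.2 ⟨_, Finset.mem_filter.2 ⟨h, rfl⟩, rfl⟩)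
    exact (Finset.card_le_card this).trans ((Finset.card_union_le _ _).trans
      (Nat.add_le_add Finset.card_image_le Finset.card_image_le))
  refine (Finset.sum_le_sum fun i _ => h1 i).trans ?_
  have e1 : ∑ i, ((visiblePairs φ h C).filter fun p => p.1 = i).card = (visiblePairs φ h C).card :=
    (Finset.card_eq_sum_card_fiberwise fun p _ => Finset.mem_coe.2 (Finset.mem_univ p.1)).symm
  have e2 : ∑ i, ((visiblePairs φ h C).filter fun p => p.2 = i).card = (visiblePairs φ h C).card :=
    (Finset.card_eq_sum_card_fiberwise fun p _ => Finset.mem_coe.2 (Finset.mem_univ p.2)).symm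
  rw [Finset.sum_add_distrib, e1, e2, two_mul]

variable [Fintype ι] {f : ι → ι → E →ₗ[ℝ] ℝ} {u : ι → ι → ℝ}

/-- The polyhedron cut out by the separating lines of the neighbours of `C i`, restricted to the
fibres that meet `C i`, misses the other members of the family. -/
theorem disjoint_of_lt_neighbours (hφ : ∀ p, φ p = 0 → h p = 0 → p = 0)
    (hc : ∀ i, Convex ℝ (C i)) (hd : Pairwise fun i j => Disjoint (C i) (C j))
    (hf : ∀ i j, i ≠ j → (∀ p ∈ C i, f i j p < u i j) ∧ ∀ p ∈ C j, u i j < f i j p)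
    {i j : ι} (hij : i ≠ j) {y z : E} (hy : y ∈ C i) (hyz : φ y = φ z)
    (hz : ∀ k ∈ neighbours φ h C i, f i k z < u i k) : z ∉ C j := by
  classical
  intro hzj
  have hia : i ∈ activeOn φ C (φ z) := by simpa [activeOn] using ⟨y, hy, hyz⟩
  have hja : j ∈ activeOn φ C (φ z) := by simpa [activeOn] using ⟨z, hzj, rfl⟩
  have hR := isStrictLinearOn_isBelow hφ hc hd (activeOn φ C (φ z)) (φ z)
    fun i hi => by simpa [activeOn] using hi
  have hconv : ∀ k, Convex ℝ {p | f i k p < u i k} :=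
    fun k => convex_halfSpace_lt (f i k).isLinear _
  rcases hR.total i hia j hja hij with hlt | hlt
  · obtain ⟨k, hk, hkj⟩ := exists_consecutive_of_rel hR hia hja hlt
    have hkN : k ∈ neighbours φ h C i := by
      simp only [neighbours, visiblePairs, Finset.mem_filter, Finset.mem_univ, true_and]
      exact Or.inl ⟨_, hk⟩
    have hik := ne_of_mem_neighbours hkN
    rcases hkj with rfl | hkj
    · exact lt_asymm (hz k hkN) ((hf i k hij).2 z hzj)
    -- Here `C k` has a point `w` between `y` and `z` on the fibre. The half-plane `f i k < u i k`
    -- contains `y` and `z`, hence `w`, which lies on the other side.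
    · rw [mem_consecutivePairs] at hk
      obtain ⟨w, hw, hwz⟩ : φ z ∈ φ '' C k := by simpa [activeOn] using hk.2.1
      have h1 := hk.2.2.1.lt hφ hc hd hy hw (hyz.trans hwz.symm)
      have h2 := hkj.lt hφ hc hd hw hzj hwz
      exact lt_asymm ((hconv k).mem_of_coord_between hφ ((hf i k hik).1 y hy) (hz k hkN)
        hyz hwz h1 h2) ((hf i k hik).2 w hw)
  · obtain ⟨k, hk, hkj⟩ := exists_consecutive_of_rel' hR hia hja hlt
    have hkN : k ∈ neighbours φ h C i := by
      simp only [neighbours, visiblePairs, Finset.mem_filter, Finset.mem_univ, true_and]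
      exact Or.inr ⟨_, hk⟩
    have hik := ne_of_mem_neighbours hkN
    rcases hkj with rfl | hkj
    · exact lt_asymm (hz k hkN) ((hf i k hij).2 z hzj)
    · rw [mem_consecutivePairs] at hk
      obtain ⟨w, hw, hwz⟩ : φ z ∈ φ '' C k := by simpa [activeOn] using hk.1
      have h1 := hk.2.2.1.lt hφ hc hd hw hy (hwz.trans hyz.symm)
      have h2 := hkj.lt hφ hc hd hzj hw hwz.symm
      exact lt_asymm ((hconv k).mem_of_coord_between hφ (hz k hkN) ((hf i k hik).1 y hy)
        hyz.symm (hwz.trans hyz.symm) h2 h1) ((hf i k hik).2 w hw)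

end Neighbours

/-! ### Neighbours suffice to cut out a maximal member. -/

section Maximal

variable {E ι : Type*} [AddCommGroup E] [Module ℝ E] [TopologicalSpace E]
  [IsTopologicalAddGroup E] [ContinuousSMul ℝ E] [Fintype ι] {C : ι → Set E}
  {φ h : E →ₗ[ℝ] ℝ} {v : E} {f : ι → ι → StrongDual ℝ E} {u : ι → ι → ℝ}

/-- Each member of a maximal family of disjoint open convex sets is cut out by the separating
lines of its neighbours. -/
theorem eq_setOf_lt_neighbours
    (hφ : ∀ p, φ p = 0 → h p = 0 → p = 0) (hφv : φ v = 0)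
    (hv : ∀ i j, f i j ≠ 0 → f i j v ≠ 0)
    (ho : ∀ i, IsOpen (C i)) (hc : ∀ i, Convex ℝ (C i))
    (hd : Pairwise fun i j => Disjoint (C i) (C j))
    (hmax : ∀ i T, IsOpen T → Convex ℝ T → C i ⊆ T → (∀ j, j ≠ i → Disjoint T (C j)) → T ⊆ C i)
    (hf : ∀ i j, i ≠ j → (∀ p ∈ C i, f i j p < u i j) ∧ ∀ p ∈ C j, u i j < f i j p)
    {i : ι} (hne : (C i).Nonempty) :
    C i = {p | ∀ k ∈ neighbours φ h C i, f i k p < u i k} := by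
  classical
  set Q : Set E := {p | ∀ k ∈ neighbours φ h C i, f i k p < u i k} with hQ
  have hQeq : Q = ⋂ k ∈ neighbours φ h C i, {p | f i k p < u i k} := by
    ext; simp [hQ]
  have hQo : IsOpen Q := by
    rw [hQeq]
    exact isOpen_biInter_finset fun k _ => isOpen_lt (f i k).continuous continuous_const
  have hQc : Convex ℝ Q := by
    rw [hQeq]
    exact convex_iInter₂ fun k _ => convex_halfSpace_lt (f i k).toLinearMap.isLinear _
  have hCQ : C i ⊆ Q := fun p hp k hk => (hf i k (ne_of_mem_neighbours hk)).1 p hp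
  -- The intersection of all the half-planes is an admissible enlargement of `C i`.
  have hall : ∀ q, (∀ j, j ≠ i → f i j q < u i j) → q ∈ C i := by
    have hsub : {q | ∀ j, j ≠ i → f i j q < u i j} ⊆ C i := by
      have heq : {q | ∀ j, j ≠ i → f i j q < u i j} =
          ⋂ j ∈ Finset.univ.filter (· ≠ i), {p | f i j p < u i j} := by
        ext; simp
      apply hmax i
      · rw [heq]
        exact isOpen_biInter_finset fun k _ => isOpen_lt (f i k).continuous continuous_const
      · rw [heq]
        exact convex_iInter₂ fun k _ => convex_halfSpace_lt (f i k).toLinearMap.isLinear _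
      · exact fun p hp j hj => (hf i j hj.symm).1 p hp
      · exact fun j hj => Set.disjoint_left.2 fun q hq hqj =>
          lt_asymm (hq j hj) ((hf i j hj.symm).2 q hqj)
    exact fun q hq => hsub hq
  -- So is the part of `Q` on fibres that meet `C i`, by `disjoint_of_lt_neighbours`.
  have hstrip : ∀ q ∈ Q, ∀ t : ℝ, q + t • v ∈ C i → q ∈ C i := by
    have hsub : Q ∩ {q | ∃ t : ℝ, q + t • v ∈ C i} ⊆ C i := by
      apply hmax i
      · refine hQo.inter ?_
        have : {q | ∃ t : ℝ, q + t • v ∈ C i} = ⋃ t : ℝ, (fun q => q + t • v) ⁻¹' C i := by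
          ext; simp
        rw [this]
        exact isOpen_iUnion fun t => (ho i).preimage (continuous_id.add continuous_const)
      · refine hQc.inter ?_
        rintro p ⟨t, ht⟩ q ⟨s, hs⟩ a b ha hb hab
        refine ⟨a * t + b * s, ?_⟩
        have := hc i ht hs ha hb hab
        convert this using 1
        module
      · exact fun p hp => ⟨hCQ hp, 0, by simpa using hp⟩
      · rintro j hj
        refine Set.disjoint_left.2 ?_
        rintro z ⟨hzQ, t, ht⟩
        exact disjoint_of_lt_neighbours (f := fun i j => (f i j : E →ₗ[ℝ] ℝ)) hφ hc hd hf hj.symm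
          ht (by simp [hφv]) hzQ
    exact fun q hq t ht => hsub ⟨hq, t, ht⟩
  -- It remains to see that the open set `C i` is relatively closed in `Q`.
  refine hCQ.antisymm (hQc.isPreconnected.subset_of_closure_inter_subset (ho i)
    (hne.mono fun p hp => ⟨hCQ hp, hp⟩) ?_)
  rintro q ⟨hqcl, hqQ⟩
  by_contra hqC
  obtain ⟨j, hj, hle⟩ : ∃ j, j ≠ i ∧ u i j ≤ f i j q := by
    by_contra! hcon
    exact hqC (hall q hcon)
  obtain ⟨y, hy⟩ := hne
  have hfv : f i j v ≠ 0 := by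
    apply hv
    intro h0
    have := (hf i j hj.symm).1 y hy
    rw [h0] at this hle
    simp at this hle
    linarith
  -- This shift raises `f i j` by `ε * (f i j v) ^ 2`, so `q` moves strictly beyond the line while
  -- staying in `Q`. A nearby point of `C i` does the same, yet `hstrip` keeps its shift in `C i`.
  have hcont : Filter.Tendsto (fun ε : ℝ => q + (ε * f i j v) • v) (𝓝[>] 0) (𝓝 q) := by
    have : Continuous fun ε : ℝ => q + (ε * f i j v) • v := by fun_prop
    simpa using (this.tendsto 0).mono_left nhdsWithin_le_nhds
  obtain ⟨ε, hεQ, hε⟩ := ((hcont.eventually (hQo.mem_nhds hqQ)).and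
    self_mem_nhdsWithin).exists
  have hgt : u i j < f i j (q + (ε * f i j v) • v) := by
    have : 0 < f i j v * f i j v := mul_self_pos.2 hfv
    simp only [map_add, map_smul, smul_eq_mul]
    nlinarith [mul_pos hε this]
  have hWo : IsOpen {w : E | w + (ε * f i j v) • v ∈ Q ∧
      u i j < f i j (w + (ε * f i j v) • v)} := by
    have hco : Continuous fun w : E => w + (ε * f i j v) • v := by fun_prop
    exact (hQo.preimage hco).inter (isOpen_lt continuous_const ((f i j).continuous.comp hco))
  obtain ⟨c, ⟨hcQ, hcu⟩, hcC⟩ := mem_closure_iff.1 hqcl _ hWo ⟨hεQ, hgt⟩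
  have := hstrip _ hcQ (-(ε * f i j v)) (by simpa using hcC)
  exact lt_asymm hcu ((hf i j hj.symm).1 _ this)

end Maximal


/-! ### Polyhedra and their facets. -/

theorem isConvexPolyhedron_setOf_le {ι : Type*} (K : Finset ι) (g : ι → StrongDual ℝ Plane)
    (u : ι → ℝ) : IsConvexPolyhedron {p | ∀ k ∈ K, g k p ≤ u k} := by
  let e := K.equivFin
  refine ⟨K.card, fun j => -(InnerProductSpace.toDual ℝ Plane).symm (g (e.symm j)),
    fun j => -u (e.symm j), ?_⟩
  ext p
  simp only [mem_ofPred_eq, inner_neg_left, InnerProductSpace.toDual_symm_apply, neg_le_neg_iff]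
  constructor
  · exact fun h j => h _ (e.symm j).2
  · intro h k hk
    simpa using h (e ⟨k, hk⟩)

theorem isConvexPolyhedron_setOf_eq (g : StrongDual ℝ Plane) (u : ℝ) :
    IsConvexPolyhedron {p | g p = u} := by
  convert isConvexPolyhedron_setOf_le Finset.univ ![g, -g] ![u, -u] using 1
  ext p
  simp [Fin.forall_fin_two, le_antisymm_iff]

/-- If a functional is maximal at `z`, comparing `w` with its reflection `2 • z - w` shows that it
is constant. Hence the only nonempty exposed face is the whole set, whose dimension is not one less.
-/
theorem facets_setOf_eq (g : StrongDual ℝ Plane) (u : ℝ) : facets {p | g p = u} = ∅ := by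
  rw [Set.eq_empty_iff_forall_notMem]
  rintro F ⟨hne, hexp, hdim⟩
  obtain ⟨l, rfl⟩ := hexp hne
  obtain ⟨z, hz, hzl⟩ := hne
  have : {x ∈ {p | g p = u} | ∀ y ∈ {p | g p = u}, l y ≤ l x} = {p | g p = u} := by
    refine Set.Subset.antisymm (fun p hp => hp.1) fun w hw => ⟨hw, fun y hy => ?_⟩
    have h1 := hzl y hy
    have h2 := hzl (2 • z - w) (by
      simp only [mem_ofPred_eq] at hz hw
      simp only [mem_ofPred_eq, map_sub, map_nsmul, hz, hw]
      simp [two_mul])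
    simp only [map_sub, map_nsmul, nsmul_eq_mul, Nat.cast_ofNat] at h2
    linarith
  rw [this] at hdim
  omega

theorem interior_setOf_eq_eq_empty {g : StrongDual ℝ Plane} (hg : g ≠ 0) (u : ℝ) :
    interior {p | g p = u} = ∅ := by
  rw [Set.eq_empty_iff_forall_notMem]
  intro p hp
  apply hg
  have hpu : p ∈ {p | g p = u} := interior_subset hp
  have h1 : IsLocalMax g p := by
    filter_upwards [mem_interior_iff_mem_nhds.1 hp] with q hq
    exact (show g q = u from hq).trans_le (show g p = u from hpu).ge
  simpa using h1.fderiv_eq_zero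

theorem exists_subset_line {D : Set Plane} (hD : Convex ℝ D) (h : ¬ (interior D).Nonempty) :
    ∃ g : StrongDual ℝ Plane, g ≠ 0 ∧ ∃ u, D ⊆ {p | g p = u} := by
  rw [hD.interior_nonempty_iff_affineSpan_eq_top] at h
  rcases D.eq_empty_or_nonempty with rfl | ⟨x, hx⟩
  · obtain ⟨g, hg⟩ := exists_ne (0 : StrongDual ℝ Plane)
    exact ⟨g, hg, 0, Set.empty_subset _⟩
  · have hlt : vectorSpan ℝ D < ⊤ := by
      rw [lt_top_iff_ne_top]
      exact fun htop => h ((AffineSubspace.affineSpan_eq_top_iff_vectorSpan_eq_top_of_nonempty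
        ℝ Plane Plane ⟨x, hx⟩).2 htop)
    obtain ⟨g, hg, hle⟩ := Submodule.exists_le_ker_of_lt_top _ hlt
    refine ⟨LinearMap.toContinuousLinearMap g, by simpa using hg, g x, fun y hy => ?_⟩
    have : y - x ∈ LinearMap.ker g := hle (vsub_mem_vectorSpan ℝ hy hx)
    simpa [sub_eq_zero] using this

section Facets

variable {ι : Type*} {K : Finset ι} {g : ι → StrongDual ℝ Plane} {u : ι → ℝ}

theorem isOpen_setOf_forall_lt : IsOpen {p | ∀ k ∈ K, g k p < u k} := by
  have : {p | ∀ k ∈ K, g k p < u k} = ⋂ k ∈ K, {p | g k p < u k} := by ext; simp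
  rw [this]
  exact isOpen_biInter_finset fun k _ => isOpen_lt (g k).continuous continuous_const

theorem closure_setOf_forall_lt (hne : {p | ∀ k ∈ K, g k p < u k}.Nonempty) :
    closure {p | ∀ k ∈ K, g k p < u k} = {p | ∀ k ∈ K, g k p ≤ u k} := by
  apply Set.Subset.antisymm
  · refine closure_minimal (fun p hp k hk => (hp k hk).le) ?_
    have : {p | ∀ k ∈ K, g k p ≤ u k} = ⋂ k ∈ K, {p | g k p ≤ u k} := by ext; simp
    rw [this]
    exact isClosed_biInter fun k _ => isClosed_le (g k).continuous continuous_const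
  · intro x hx
    obtain ⟨y, hy⟩ := hne
    have hcont : Filter.Tendsto (fun ε : ℝ => (1 - ε) • x + ε • y) (𝓝[>] 0) (𝓝 x) := by
      have : Continuous fun ε : ℝ => (1 - ε) • x + ε • y := by fun_prop
      simpa using (this.tendsto 0).mono_left nhdsWithin_le_nhds
    refine mem_closure_of_tendsto hcont ?_
    filter_upwards [Ioo_mem_nhdsGT one_pos] with ε hε k hk
    have h1 := hx k hk
    have h2 := hy k hk
    simp only [map_add, map_smul, smul_eq_mul]
    nlinarith [hε.1, hε.2]

/-- In the plane, two functionals vanishing at a common nonzero vector are proportional. -/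
theorem apply_eq_zero_of_common_zero {l m : StrongDual ℝ Plane} {d w : Plane} (hd : d ≠ 0)
    (hm : m ≠ 0) (hmd : m d = 0) (hld : l d = 0) (hmw : m w = 0) : l w = 0 := by
  have hker : Module.finrank ℝ (LinearMap.ker (m : Plane →ₗ[ℝ] ℝ)) = 1 := by
    have h1 := LinearMap.finrank_range_add_finrank_ker (m : Plane →ₗ[ℝ] ℝ)
    have h2 : LinearMap.range (m : Plane →ₗ[ℝ] ℝ) = ⊤ :=
      LinearMap.range_eq_top.2 (LinearMap.surjective fun h0 => hm (ContinuousLinearMap.coe_injective h0))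
    rw [h2] at h1
    simp at h1
    omega
  obtain ⟨c, hc⟩ := (finrank_eq_one_iff_of_nonzero' (⟨d, hmd⟩ : LinearMap.ker
    (m : Plane →ₗ[ℝ] ℝ)) fun h0 => hd (congrArg Subtype.val h0)).1 hker ⟨w, hmw⟩
  have : c • d = w := congrArg Subtype.val hc
  rw [← this, map_smul, hld, smul_zero]

/-- A facet maximises a nonzero functional `l`, so it contains no strictly feasible point, and by
convexity one constraint is tight on all of it. It also contains two points, so `l` is constant
along that constraint line and the facet is all of the polyhedron on the line. -/
theorem exists_facet_eq (hne : {p | ∀ k ∈ K, g k p < u k}.Nonempty) {F : Set Plane}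
    (hF : F ∈ facets {p | ∀ k ∈ K, g k p ≤ u k}) :
    ∃ k ∈ K, F = {p | (∀ k ∈ K, g k p ≤ u k) ∧ g k p = u k} := by
  set P : Set Plane := {p | ∀ k ∈ K, g k p ≤ u k} with hP
  obtain ⟨hFne, hexp, hdim⟩ := hF
  obtain ⟨l, hl⟩ := hexp hFne
  have hFP : F ⊆ P := fun p hp => by rw [hl] at hp; exact hp.1
  have hmax : ∀ p ∈ F, ∀ y ∈ P, l y ≤ l p := fun p hp => by rw [hl] at hp; exact hp.2
  have hFc : Convex ℝ F := by
    refine hexp.convex ?_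
    have : P = ⋂ k ∈ K, {p | g k p ≤ u k} := by ext; simp [hP]
    rw [this]
    exact convex_iInter₂ fun k _ => convex_halfSpace_le (g k).toLinearMap.isLinear _
  have hopen := isOpen_setOf_forall_lt (K := K) (g := g) (u := u)
  have hsub : {p | ∀ k ∈ K, g k p < u k} ⊆ P := fun p hp k hk => (hp k hk).le
  have hPdim : Module.finrank ℝ (vectorSpan ℝ P) = 2 := by
    have h1 : affineSpan ℝ P = ⊤ := by
      refine top_unique ?_
      rw [← hopen.affineSpan_eq_top hne]
      exact affineSpan_mono ℝ hsub
    rw [← direction_affineSpan, h1, AffineSubspace.direction_top, finrank_top]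
    simp
  have hl0 : l ≠ 0 := by
    rintro rfl
    have : F = P := by rw [hl]; ext; simp
    rw [this] at hdim
    omega
  have hdisj : ∀ z ∈ F, ¬ ∀ k ∈ K, g k z < u k := by
    intro z hz hzK
    apply hl0
    have h1 : IsLocalMax l z := by
      filter_upwards [hopen.mem_nhds hzK] with q hq
      exact hmax z hz q (hsub hq)
    simpa using h1.fderiv_eq_zero
  have hexists : ∃ k ∈ K, ∀ z ∈ F, g k z = u k := by
    classical
    by_contra! hcon
    -- Midpoints accumulate strict inequalities: a constraint strict at either endpoint is strict at
    -- the midpoint.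
    have key : ∀ T ⊆ K, ∃ z ∈ F, ∀ k ∈ T, g k z < u k := by
      intro T
      induction T using Finset.induction_on with
      | empty => exact fun _ => ⟨hFne.some, hFne.some_mem, by simp⟩
      | insert k T _ ih =>
        intro hT
        have hkK := hT (Finset.mem_insert_self _ _)
        obtain ⟨z, hz, hzT⟩ := ih ((Finset.subset_insert _ _).trans hT)
        obtain ⟨w, hw, hwk⟩ := hcon k hkK
        refine ⟨(1 / 2 : ℝ) • z + (1 / 2 : ℝ) • w,
          hFc hz hw (by norm_num) (by norm_num) (by norm_num), fun m hm => ?_⟩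
        have hmK := hT hm
        simp only [map_add, map_smul, smul_eq_mul]
        rcases Finset.mem_insert.1 hm with rfl | hm
        · have h1 := hFP hz m hmK
          have h2 := lt_of_le_of_ne (hFP hw m hmK) hwk
          linarith
        · have h1 := hzT m hm
          have h2 := hFP hw m hmK
          linarith
    obtain ⟨z, hz, hzK⟩ := key K subset_rfl
    exact hdisj z hz hzK
  obtain ⟨k, hk, hFk⟩ := hexists
  refine ⟨k, hk, Set.Subset.antisymm (fun p hp => ⟨hFP hp, hFk p hp⟩) ?_⟩
  rintro w ⟨hwP, hwk⟩
  have hnontriv : F.Nontrivial := by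
    by_contra hnt
    rw [Set.not_nontrivial_iff] at hnt
    rw [vectorSpan_of_subsingleton ℝ hnt, finrank_bot] at hdim
    omega
  obtain ⟨z, hz, z', hz', hzz⟩ := hnontriv
  obtain ⟨y, hy⟩ := hne
  have hg0 : g k ≠ 0 := by
    intro h0
    have h1 := hy k hk
    have h2 := hFk z hz
    rw [h0] at h1 h2
    simp at h1 h2
    linarith
  have hlw : l (w - z) = 0 := by
    refine apply_eq_zero_of_common_zero (sub_ne_zero.2 hzz) hg0 ?_ ?_ ?_
    · rw [map_sub, hFk z hz, hFk z' hz', sub_self]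
    · rw [map_sub, sub_eq_zero]
      exact le_antisymm (hmax z' hz' z (hFP hz)) (hmax z hz z' (hFP hz'))
    · rw [map_sub, hFk z hz, hwk, sub_self]
  rw [map_sub, sub_eq_zero] at hlw
  rw [hl]
  exact ⟨hwP, fun y hy => by rw [hlw]; exact hmax z hz y hy⟩

theorem encard_facets_le (hne : {p | ∀ k ∈ K, g k p < u k}.Nonempty) :
    (facets {p | ∀ k ∈ K, g k p ≤ u k}).encard ≤ K.card := by
  have hsub : facets {p | ∀ k ∈ K, g k p ≤ u k} ⊆
      (fun k => {p | (∀ k ∈ K, g k p ≤ u k) ∧ g k p = u k}) '' (K : Set ι) := by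
    intro F hF
    obtain ⟨k, hk, rfl⟩ := exists_facet_eq hne hF
    exact ⟨k, hk, rfl⟩
  refine (Set.encard_le_encard hsub).trans ((Set.encard_image_le _ _).trans ?_)
  rw [Set.encard_coe_eq_coe_finsetCard]

end Facets

/-! ### Assembling the bound. -/

/-- Disjoint open convex sets in the plane are contained in disjoint open convex sets whose
closures are polyhedra with at most `6 * a - 12` facets in total. -/
theorem exists_open_polyhedra {a : ℕ} (ha : 3 ≤ a) (O : Fin a → Set Plane)
    (hO : ∀ i, IsOpen (O i)) (hc : ∀ i, Convex ℝ (O i))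
    (hd : Pairwise fun i j => Disjoint (O i) (O j)) :
    ∃ C : Fin a → Set Plane, (∀ i, O i ⊆ C i) ∧ (∀ i, IsOpen (C i)) ∧
      (Pairwise fun i j => Disjoint (C i) (C j)) ∧ (∀ i, IsConvexPolyhedron (closure (C i))) ∧
      totalFacets (fun i => closure (C i)) ≤ ((6 * a - 12 : ℕ) : ℕ∞) := by
  obtain ⟨C, hOC, hCo, hCc, hCd, hmax⟩ := exists_maximal_disjoint_open_convex O hO hc hd
  have hsep : ∀ i j, ∃ (f : StrongDual ℝ Plane) (u : ℝ), i ≠ j →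
      (∀ p ∈ C i, f p < u) ∧ ∀ p ∈ C j, u < f p := by
    intro i j
    by_cases hij : i = j
    · exact ⟨0, 0, fun h => absurd hij h⟩
    · obtain ⟨f, u, hf⟩ := geometric_hahn_banach_open_open (hCc i) (hCo i) (hCc j) (hCo j)
        (hCd hij)
      exact ⟨f, u, fun _ => hf⟩
  choose f u hf using hsep
  obtain ⟨φ, h, v, hφv, hφ, hv⟩ :=
    exists_transversal_direction fun p : Fin a × Fin a => f p.1 p.2
  have hcut : ∀ i, (C i).Nonempty → C i = {p | ∀ k ∈ neighbours φ h C i, f i k p < u i k} :=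
    fun i hi => eq_setOf_lt_neighbours hφ hφv (fun i j => hv (i, j)) hCo hCc hCd hmax hf hi
  have hclosure : ∀ i, (C i).Nonempty →
      closure (C i) = {p | ∀ k ∈ neighbours φ h C i, f i k p ≤ u i k} := by
    intro i hi
    have heq := hcut i hi
    conv_lhs => rw [heq]
    exact closure_setOf_forall_lt (heq ▸ hi)
  refine ⟨C, hOC, hCo, hCd, fun i => ?_, ?_⟩
  · rcases (C i).eq_empty_or_nonempty with hi | hi
    · rw [hi, closure_empty]
      -- The empty set as the infeasible constraint `1 ≤ 0`.
      exact ⟨1, 0, 1, by ext; simp⟩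
    · rw [hclosure i hi]
      exact isConvexPolyhedron_setOf_le _ _ _
  · have hle : ∀ i, (facets (closure (C i))).encard ≤ ((neighbours φ h C i).card : ℕ∞) := by
      intro i
      rcases (C i).eq_empty_or_nonempty with hi | hi
      · have : facets (closure (C i)) = ∅ := by
          rw [hi, closure_empty, Set.eq_empty_iff_forall_notMem]
          rintro F ⟨hne, hexp, -⟩
          exact (hne.mono hexp.subset).ne_empty rfl
        simp [this]
      · rw [hclosure i hi]
        exact encard_facets_le ((hcut i hi) ▸ hi)
    refine (Finset.sum_le_sum fun i _ => hle i).trans ?_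
    have h1 := sum_card_neighbours_le (φ := φ) (h := h) (C := C)
    have h2 := card_visiblePairs_le (φ := φ) (h := h) (C := C) (by simpa using ha) hφ hCc hCd
    rw [Fintype.card_fin] at h2
    rw [← Nat.cast_sum]
    exact_mod_cast (show ∑ i, (neighbours φ h C i).card ≤ 6 * a - 12 by omega)

theorem disjoint_interior_closure {X : Type*} [TopologicalSpace X] {U V : Set X}
    (hV : IsOpen V) (h : Disjoint U V) :
    Disjoint (interior (closure U)) (interior (closure V)) :=
  ((((h.closure_left hV).mono_left interior_subset).closure_right isOpen_interior)).mono_right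
    interior_subset

theorem exists_disjoint_thickenings {a : ℕ} {D : Fin a → Set Plane} (hD : ∀ i, IsCompact (D i))
    (hd : Pairwise fun i j => Disjoint (D i) (D j)) :
    ∃ δ, 0 < δ ∧ Pairwise fun i j =>
      Disjoint (Metric.thickening δ (D i)) (Metric.thickening δ (D j)) := by
  have hpair : ∀ p : Fin a × Fin a, ∀ᶠ δ in 𝓝[>] (0 : ℝ), p.1 ≠ p.2 →
      Disjoint (Metric.thickening δ (D p.1)) (Metric.thickening δ (D p.2)) := by
    rintro ⟨i, j⟩
    by_cases hij : i = j
    · exact Filter.Eventually.of_forall fun δ h => absurd hij h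
    · obtain ⟨r, hr, hdis⟩ := (hd hij).exists_thickenings (hD i) (hD j).isClosed
      filter_upwards [Ioo_mem_nhdsGT hr] with δ hδ _
      exact hdis.mono (Metric.thickening_mono hδ.2.le _) (Metric.thickening_mono hδ.2.le _)
  obtain ⟨δ, hδ, hpos⟩ := ((Filter.eventually_all.2 hpair).and self_mem_nhdsWithin).exists
  exact ⟨δ, hpos, fun i j hij => hδ (i, j) hij⟩

theorem theorem4p6 (a : ℕ) (ha : 3 ≤ a) :
    minFacetBound a ≤ ((6 * a - 12 : ℕ) : ℕ∞) ∧
    ∀ D : Fin a → Set Plane, (∀ i, (D i).Nonempty) → (∀ i, IsCompact (D i)) →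
      (∀ i, Convex ℝ (D i)) → (Pairwise fun i j => Disjoint (D i) (D j)) →
      ∃ P : Fin a → Set Plane, IsSeparatingSystem D P ∧ (∀ i, (interior (P i)).Nonempty) ∧
        totalFacets P ≤ ((6 * a - 12 : ℕ) : ℕ∞) := by
  classical
  constructor
  · refine sInf_le fun D hDc hDd => ?_
    obtain ⟨C, hOC, hCo, hCd, hCp, hCf⟩ := exists_open_polyhedra ha (fun i => interior (D i))
      (fun i => isOpen_interior) (fun i => (hDc i).interior)
      (fun i j hij => (hDd hij).mono interior_subset interior_subset)
    have hP : ∀ i, ∃ P : Set Plane, IsConvexPolyhedron P ∧ D i ⊆ P ∧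
        interior P ⊆ interior (closure (C i)) ∧
        (facets P).encard ≤ (facets (closure (C i))).encard := by
      intro i
      -- A convex set with interior lies in the closure of that interior; otherwise a line contains
      -- it, at no cost in facets or interior overlap.
      by_cases hi : (interior (D i)).Nonempty
      · refine ⟨closure (C i), hCp i, ?_, subset_rfl, le_rfl⟩
        refine subset_closure.trans ?_
        rw [← (hDc i).closure_interior_eq_closure_of_nonempty_interior hi]
        exact closure_mono (hOC i)
      · obtain ⟨g, hg, u, hgu⟩ := exists_subset_line (hDc i) hi
        refine ⟨_, isConvexPolyhedron_setOf_eq g u, hgu, ?_, ?_⟩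
        · rw [interior_setOf_eq_eq_empty hg]; exact Set.empty_subset _
        · simp [facets_setOf_eq]
    choose P hPp hDP hPi hPf using hP
    exact ⟨P, ⟨hPp, hDP, fun i j hij => (disjoint_interior_closure (hCo j)
      (hCd hij)).mono (hPi i) (hPi j)⟩, (Finset.sum_le_sum fun i _ => hPf i).trans hCf⟩
  · intro D hne hDcomp hDc hDd
    obtain ⟨δ, hδ, hdis⟩ := exists_disjoint_thickenings hDcomp hDd
    obtain ⟨C, hOC, hCo, hCd, hCp, hCf⟩ := exists_open_polyhedra ha
      (fun i => Metric.thickening δ (D i)) (fun i => Metric.isOpen_thickening)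
      (fun i => (hDc i).thickening δ) hdis
    have hDC : ∀ i, D i ⊆ C i := fun i => (Metric.self_subset_thickening hδ _).trans (hOC i)
    refine ⟨fun i => closure (C i), ⟨hCp, fun i => (hDC i).trans subset_closure,
      fun i j hij => disjoint_interior_closure (hCo j) (hCd hij)⟩, fun i => ?_, hCf⟩
    exact ((hne i).mono (hDC i)).mono (interior_maximal subset_closure (hCo i))
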